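/- Let $n\ge 1$ and let $K\subset\mathbb R^n$ be a compact convex set with $0$ in its interior, whose boundary is of class $C^2$ with strictly positive principal curvatures. Let $K^0=\{p:\langle p,x\rangle\le 1\ \forall x\in K\}$ be its polar set, and let $\rho$, $\rho^0$ be the gauge functions of $K$ and $K^0$, i.e. $\rho(\xi)=\inf\{t\ge 0:\xi\in tK\}$, $\rho^0(\xi)=\inf\{t\ge 0:\xi\in tK^0\}$. Let $\Omega\subset\mathbb R^n$ be a nonempty, bounded, open, connected set of class $C^2$ and let $S$ be a nonempty closed subset of $\overline\Omega$. For $x\in\overline\Omega$ define $$d(x)=\min_{y\in\partial\Omega}\rho^0(x-y),\qquad \Pi(x)=\{y\in\partial\Omega: d(x)=\rho^0(x-y)\},\qquad u_S(x)=\max_{z\in S\cup\partial\Omega}\,[d(z)-\rho^0(z-x)].$$ Let $\Sigma$ be the set of points of $\Omega$ at which $d$ is not differentiable, and let $\mathrm{Lip}_0^1(\Omega,\rho)$ be the set of all $u\in C(\overline\Omega)$ with $u=0$ on $\partial\Omega$ and $u(x)-u(y)\le\rho^0(x-y)$ whenever the closed segment $[x,y]$ is contained in $\overline\Omega$. Let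 $S^*$ be the set of those $z^*\in S$ such that $z\in S$, $y\in\Pi(z)$, $z^*\in[y,z]$ imply $z=z^*$, and set $$T_S^e=\bigcup_{z\in S^*,\ y\in\Pi(z)}[y,z].$$ Then $u_S\in\mathrm{Lip}_0^1(\Omega,\rho)$, and the following hold. (i) $T_S^e$ is closed, $S\subseteq T_S^e$, $u_S=d$ on $T_S^e$, and for a.e. $x\in T_S^e$ both $u_S$ and $d$ are differentiable at $x$ with $Du_S(x)=Dd(x)$. (ii) For a.e. $x\in\Omega$, $u_S$ is differentiable at $x$ and $\rho(Du_S(x))=1$. (iii) If $u\in\mathrm{Lip}_0^1(\Omega,\rho)$ and $u=d$ on $S$, then $u_S\le u\le d$ in $\overline\Omega$, and for a.e. $x\in T_S^e$ both $u$ and $d$ are differentiable at $x$ with $Du(x)=Dd(x)$. (iv) $u_S=d$ in $\overline\Omega$ if and only if $\Sigma\subseteq S$. -/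

import Mathlib

open MeasureTheory

noncomputable section

namespace MinkowskiDist

/-- Euclidean space `ℝⁿ`. -/
abbrev E (n : ℕ) : Type := EuclideanSpace ℝ (Fin n)

/-- The bounded open set `O ⊆ ℝⁿ` is of class `C²`: around every boundary point there is a ball `B`
and a `C²` diffeomorphism `ψ` from `B` onto an open set that maps `B ∩ O` into `{xₙ > 0}` and
`B ∩ ∂O` into `{xₙ = 0}` (`i` is the index of the last coordinate). -/
def IsOfClassC2 {n : ℕ} (O : Set (E n)) : Prop :=
  IsOpen O ∧ Bornology.IsBounded O ∧
    ∀ x₀ ∈ frontier O, ∃ r : ℝ, 0 < r ∧ ∃ ψ : OpenPartialHomeomorph (E n) (E n),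
      ψ.source = Metric.ball x₀ r ∧
      ContDiffOn ℝ 2 ψ ψ.source ∧ ContDiffOn ℝ 2 ψ.symm ψ.target ∧
      ∃ i : Fin n, (i : ℕ) + 1 = n ∧
        (∀ x ∈ Metric.ball x₀ r ∩ O, 0 < ψ x i) ∧
        (∀ x ∈ Metric.ball x₀ r ∩ frontier O, ψ x i = 0)

/-- `φ` is a `C²` local defining function of the open set `O` on the open set `U`:
`O = {φ < 0}` and `∂O = {φ = 0}` in `U`, and `Dφ` does not vanish in `U`. In particular
`Dφ / |Dφ|` is the outward unit normal of `O` on `U ∩ ∂O`. -/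
def IsDefiningFunctionOn {n : ℕ} (O U : Set (E n)) (φ : E n → ℝ) : Prop :=
  IsOpen U ∧ ContDiffOn ℝ 2 φ U ∧
    ∀ x ∈ U, fderiv ℝ φ x ≠ 0 ∧ (x ∈ O ↔ φ x < 0) ∧ (x ∈ frontier O ↔ φ x = 0)

/-- `κ` is a principal curvature of `∂O` at `x`, i.e. an eigenvalue of the second fundamental form
`(v, w) ↦ D²φ(x)(v, w) / |Dφ(x)|` on the tangent space `{v | Dφ(x) v = 0}`, where `φ` is a local
defining function of `O` near `x`. The sign is such that balls have positive curvatures. -/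
def IsPrincipalCurvature {n : ℕ} (O : Set (E n)) (x : E n) (κ : ℝ) : Prop :=
  ∃ (U : Set (E n)) (φ : E n → ℝ), x ∈ U ∧ IsDefiningFunctionOn O U φ ∧
    ∃ v : E n, v ≠ 0 ∧ fderiv ℝ φ x v = 0 ∧
      ∀ w : E n, fderiv ℝ φ x w = 0 →
        fderiv ℝ (fderiv ℝ φ) x v w / ‖fderiv ℝ φ x‖ = κ * inner ℝ v w

/-- `K` is a compact convex set with the origin in its interior, `∂K` is of class `C²`, and all
principal curvatures of `∂K` are strictly positive. -/
structure IsC2PlusBody {n : ℕ} (K : Set (E n)) : Prop where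
  isCompact : IsCompact K
  convex : Convex ℝ K
  zero_mem_interior : (0 : E n) ∈ interior K
  classC2 : IsOfClassC2 (interior K)
  curvature_pos : ∀ x ∈ frontier K, ∀ κ : ℝ, IsPrincipalCurvature (interior K) x κ → 0 < κ

/-- `Ω` is a nonempty, bounded, open, connected set of class `C²`. -/
structure IsC2Domain {n : ℕ} (Ω : Set (E n)) : Prop where
  isConnected : IsConnected Ω
  isOpen : IsOpen Ω
  isBounded : Bornology.IsBounded Ω
  classC2 : IsOfClassC2 Ω

/-- The polar set `K⁰ = {p | ⟪p, x⟫ ≤ 1 for all x ∈ K}`. -/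
def polarSet {n : ℕ} (K : Set (E n)) : Set (E n) :=
  {p | ∀ x ∈ K, inner ℝ p x ≤ 1}

/-- The gauge `ρ` of `K`. -/
def rho {n : ℕ} (K : Set (E n)) (ξ : E n) : ℝ := gauge K ξ

/-- The gauge `ρ⁰` of the polar set of `K`. -/
def rho0 {n : ℕ} (K : Set (E n)) (ξ : E n) : ℝ := gauge (polarSet K) ξ

/-- The Minkowski distance from `∂Ω`, `d(x) = min_{y ∈ ∂Ω} ρ⁰(x - y)` (only its values on the
closure of `Ω` matter; the infimum is over a nonempty compact set). -/
def minkDist {n : ℕ} (K Ω : Set (E n)) (x : E n) : ℝ :=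
  sInf ((fun y => rho0 K (x - y)) '' frontier Ω)

/-- The set `Π(x)` of projections of `x` on `∂Ω`. -/
def proj {n : ℕ} (K Ω : Set (E n)) (x : E n) : Set (E n) :=
  {y | y ∈ frontier Ω ∧ minkDist K Ω x = rho0 K (x - y)}

/-- The singular set `Σ` of the points of `Ω` at which `d` is not differentiable. -/
def singularSet {n : ℕ} (K Ω : Set (E n)) : Set (E n) :=
  {x | x ∈ Ω ∧ ¬ DifferentiableAt ℝ (minkDist K Ω) x}

/-- `u ∈ Lip¹(Ω, ρ)`: `u` is continuous on the closure of `Ω` and `u(x) - u(y) ≤ ρ⁰(x - y)`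
whenever the segment `[x, y]` lies in the closure of `Ω`. -/
def IsLip1 {n : ℕ} (K Ω : Set (E n)) (u : E n → ℝ) : Prop :=
  ContinuousOn u (closure Ω) ∧
    ∀ x y : E n, segment ℝ x y ⊆ closure Ω → u x - u y ≤ rho0 K (x - y)

/-- `u ∈ Lip₀¹(Ω, ρ)`: moreover `u = 0` on `∂Ω`. -/
def IsLip01 {n : ℕ} (K Ω : Set (E n)) (u : E n → ℝ) : Prop :=
  IsLip1 K Ω u ∧ ∀ y ∈ frontier Ω, u y = 0

/-- `u_S(x) = max_{z ∈ S ∪ ∂Ω} [d(z) - ρ⁰(z - x)]` (a supremum over a nonempty compact set). -/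
def uS {n : ℕ} (K Ω S : Set (E n)) (x : E n) : ℝ :=
  sSup ((fun z => minkDist K Ω z - rho0 K (z - x)) '' (S ∪ frontier Ω))

/-- The reduced set `S*`: the points `z* ∈ S` such that `z ∈ S`, `y ∈ Π(z)` and `z* ∈ [y, z]`
imply `z = z*`. -/
def reducedSet {n : ℕ} (K Ω S : Set (E n)) : Set (E n) :=
  {z' | z' ∈ S ∧ ∀ z ∈ S, ∀ y ∈ proj K Ω z, z' ∈ segment ℝ y z → z = z'}

/-- The extended transport set `T_S^e`: the union of the closed segments `[y, z]` with
`z ∈ S*` and `y ∈ Π(z)`. -/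
def transportSet {n : ℕ} (K Ω S : Set (E n)) : Set (E n) :=
  ⋃ z ∈ reducedSet K Ω S, ⋃ y ∈ proj K Ω z, segment ℝ y z

end MinkowskiDist

end

namespace MinkowskiDist

/-! `rho0` is the support function of `K`, and the geometry of `K` enters twice. Smoothness of `∂K`
makes `K⁰` strictly convex: equality in the triangle inequality forces a common ray
(`sameRay_of_rho0_add_eq`). Positive curvature makes `K` strictly convex: support points are unique,
so `ρ⁰` is differentiable off `0` (`differentiableAt_rho0`).

By the first fact, `x ∈ T_S^e` exactly when `d(z) = d(x) + ρ⁰(z - x)` for some `z ∈ S`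
(`mem_transportSet_iff`); closedness and `u_S = d` on `T_S^e` follow. The bounds in (iii) come from
the Lipschitz condition on segments, cut at their first exit point if they leave the closure. The
a.e. statements rest on Rademacher's theorem, on the a.e. equality of derivatives of functions that
agree on a set, and on `∂Ω` being null. For (ii), `u_S` has slope `ρ⁰(v)` in some direction `v ≠ 0`,
which puts its gradient on `∂K`.

For (iv), a maximizer `z ≠ x` with `u_S(x) = d(x)` squeezes `d` at `x` between two differentiable
functions, so singular points must lie in `S`. Conversely, among the `z` with `d(z) = d(x) + ρ⁰(z -
x)` take one with `d(z)` maximal; if it were outside `S`, `d` would be differentiable around it and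
could be continued at full rate (`exists_minkDist_ge_add`). -/

/-! ### Local defining functions from `C²` charts -/

theorem subset_of_disjoint_frontier {X : Type*} [TopologicalSpace X] {V O : Set X}
    (hV : IsPreconnected V) (hO : IsOpen O) (hne : (V ∩ O).Nonempty)
    (hd : Disjoint V (frontier O)) : V ⊆ O := by
  refine hV.subset_of_closure_inter_subset hO hne ?_
  rintro x ⟨hx, hxV⟩
  by_contra hxO
  exact Set.disjoint_left.1 hd hxV ⟨hx, by rwa [hO.interior_eq]⟩

/-- The derivative of `ψ.symm` is a right inverse of that of `ψ`, so every component of the latter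
is onto. -/
theorem fderiv_neg_chart_ne_zero {n : ℕ} (ψ : OpenPartialHomeomorph (E n) (E n)) (i : Fin n)
    {x : E n} (hx : x ∈ ψ.source) (hψ : ContDiffAt ℝ 2 ψ x) (hψs : ContDiffAt ℝ 2 ψ.symm (ψ x)) :
    fderiv ℝ (fun x => -(ψ x i)) x ≠ 0 := by
  have hd : DifferentiableAt ℝ ψ x := hψ.differentiableAt (by norm_num)
  have hyt := ψ.map_source hx
  have hds : DifferentiableAt ℝ ψ.symm (ψ x) := hψs.differentiableAt (by norm_num)
  have hcomp : (fderiv ℝ ψ x).comp (fderiv ℝ ψ.symm (ψ x)) = ContinuousLinearMap.id ℝ (E n) := by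
    have h1 : HasFDerivAt ψ (fderiv ℝ ψ x) (ψ.symm (ψ x)) := by
      rw [ψ.left_inv hx]; exact hd.hasFDerivAt
    have h2 := h1.comp (ψ x) hds.hasFDerivAt
    refine h2.unique ((hasFDerivAt_id (ψ x)).congr_of_eventuallyEq ?_)
    filter_upwards [ψ.open_target.mem_nhds hyt] with y hy
    exact ψ.right_inv hy
  have hφ : HasFDerivAt (fun x => -(ψ x i))
      (-((EuclideanSpace.proj (𝕜 := ℝ) i).comp (fderiv ℝ ψ x))) x :=
    (((EuclideanSpace.proj (𝕜 := ℝ) i).hasFDerivAt (x := ψ x)).comp x hd.hasFDerivAt).neg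
  rw [hφ.fderiv]
  intro h0
  have h1 := DFunLike.congr_fun h0 (fderiv ℝ ψ.symm (ψ x) (EuclideanSpace.single i (1 : ℝ)))
  have h2 := DFunLike.congr_fun hcomp (EuclideanSpace.single i (1 : ℝ))
  simp only [ContinuousLinearMap.comp_apply, ContinuousLinearMap.id_apply] at h2
  simp [h2] at h1

/-- A chart only bounds `ψ x i` for points of `O` and `∂O`; the converses come from connectedness.
The preimage `V` of a half ball is connected, meets `O` and avoids `∂O`, hence lies in `O`, and
zeros of the last coordinate are limits of points of `V`. -/
theorem exists_isDefiningFunctionOn {n : ℕ} {O : Set (E n)} (hO : IsOfClassC2 O) {x₀ : E n}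
    (hx₀ : x₀ ∈ frontier O) :
    ∃ (U : Set (E n)) (φ : E n → ℝ), x₀ ∈ U ∧ IsDefiningFunctionOn O U φ := by
  obtain ⟨hop, -, hloc⟩ := hO
  obtain ⟨r, hr, ψ, hsrc, hψ, hψs, i, -, hpos, hzero⟩ := hloc x₀ hx₀
  have hxs : x₀ ∈ ψ.source := by rw [hsrc]; exact Metric.mem_ball_self hr
  obtain ⟨ε, hε, hball⟩ := Metric.isOpen_iff.1 ψ.open_target _ (ψ.map_source hxs)
  obtain ⟨B, hB⟩ : ∃ B, B = Metric.ball (ψ x₀) ε := ⟨_, rfl⟩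
  have hBo : IsOpen B := hB ▸ Metric.isOpen_ball
  have hBc : Convex ℝ B := hB ▸ convex_ball _ _
  have hxB : ψ x₀ ∈ B := hB ▸ Metric.mem_ball_self hε
  rw [← hB] at hball
  clear hB
  let U := ψ.source ∩ ψ ⁻¹' B
  have hUo : IsOpen U := ψ.isOpen_inter_preimage hBo
  have hxU : x₀ ∈ U := ⟨hxs, hxB⟩
  have hposO : ∀ x ∈ U, x ∈ O → 0 < ψ x i := fun x hx h => hpos x ⟨hsrc ▸ hx.1, h⟩
  have hzeroO : ∀ x ∈ U, x ∈ frontier O → ψ x i = 0 := fun x hx h => hzero x ⟨hsrc ▸ hx.1, h⟩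
  let V := ψ.symm '' (B ∩ {y | 0 < y i})
  have hVU : V ⊆ U := by
    rintro _ ⟨y, ⟨hy, -⟩, rfl⟩
    exact ⟨ψ.map_target (hball hy), by simpa [ψ.right_inv (hball hy)] using hy⟩
  have hVpos : ∀ x ∈ V, 0 < ψ x i := by
    rintro _ ⟨y, ⟨hy, hy'⟩, rfl⟩
    rw [ψ.right_inv (hball hy)]; exact hy'
  have hmemV : ∀ x ∈ U, 0 < ψ x i → x ∈ V := fun x hx h =>
    ⟨ψ x, ⟨hx.2, h⟩, ψ.left_inv hx.1⟩
  have hVc : IsPreconnected V := by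
    refine IsPreconnected.image ?_ _
      (ψ.continuousOn_symm.mono (Set.inter_subset_left.trans hball))
    refine Convex.isPreconnected (hBc.inter ?_)
    exact convex_halfSpace_gt (f := fun y : E n => y i) ⟨fun _ _ => rfl, fun _ _ => rfl⟩ 0
  have hVO : V ⊆ O := by
    refine subset_of_disjoint_frontier hVc hop ?_ ?_
    · obtain ⟨x, hxU', hxO⟩ := mem_closure_iff.1 hx₀.1 U hUo hxU
      exact ⟨x, hmemV x hxU' (hposO x hxU' hxO), hxO⟩
    · rw [Set.disjoint_left]
      intro x hxV hxf
      exact (hVpos x hxV).ne' (hzeroO x (hVU hxV) hxf)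
  have hfr : ∀ x ∈ U, ψ x i = 0 → x ∈ frontier O := by
    intro x hx h0
    rw [hop.frontier_eq]
    refine ⟨?_, fun hxO => (hposO x hx hxO).ne' h0⟩
    have hc : Filter.Tendsto (fun t : ℝ => ψ.symm (ψ x + t • EuclideanSpace.single i (1 : ℝ)))
        (nhdsWithin 0 (Set.Ioi 0)) (nhds x) := by
      have h1 : ContinuousAt ψ.symm (ψ x + (0 : ℝ) • EuclideanSpace.single i (1 : ℝ)) := by
        rw [zero_smul, add_zero]; exact ψ.continuousAt_symm (ψ.map_source hx.1)
      have h2 : ContinuousAt (fun t : ℝ => ψ x + t • EuclideanSpace.single i (1 : ℝ)) 0 := by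
        fun_prop
      have h3 := ContinuousAt.comp (f := fun t : ℝ => ψ x + t • EuclideanSpace.single i (1 : ℝ))
        (x := (0 : ℝ)) h1 h2
      have h4 := h3.tendsto
      simp only [Function.comp_def, zero_smul, add_zero, ψ.left_inv hx.1] at h4
      exact h4.mono_left nhdsWithin_le_nhds
    have hB' : ∀ᶠ t : ℝ in nhdsWithin 0 (Set.Ioi 0),
        ψ x + t • EuclideanSpace.single i (1 : ℝ) ∈ B := by
      have h2 : ContinuousAt (fun t : ℝ => ψ x + t • EuclideanSpace.single i (1 : ℝ)) 0 := by
        fun_prop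
      refine (h2.eventually_mem ?_).filter_mono nhdsWithin_le_nhds
      rw [zero_smul, add_zero]
      exact hBo.mem_nhds hx.2
    refine mem_closure_of_tendsto hc ?_
    filter_upwards [hB', self_mem_nhdsWithin] with t ht ht0
    refine hVO ⟨_, ⟨ht, ?_⟩, rfl⟩
    have : (0 : ℝ) < t := ht0
    simpa [h0] using this
  refine ⟨U, fun x => -(ψ x i), hxU, hUo, ?_, ?_⟩
  · have h1 : ContDiffOn ℝ 2 (fun x => ψ x i) U :=
      (EuclideanSpace.proj (𝕜 := ℝ) i).contDiff.comp_contDiffOn (hψ.mono Set.inter_subset_left)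
    exact h1.neg
  · intro x hx
    refine ⟨?_, ⟨fun h => neg_neg_iff_pos.2 (hposO x hx h), fun h =>
      hVO (hmemV x hx (neg_neg_iff_pos.1 h))⟩, ⟨fun h => neg_eq_zero.2 (hzeroO x hx h), fun h =>
      hfr x hx (neg_eq_zero.1 h)⟩⟩
    exact fderiv_neg_chart_ne_zero ψ i hx.1
      (hψ.contDiffAt (ψ.open_source.mem_nhds hx.1))
      (hψs.contDiffAt (ψ.open_target.mem_nhds (ψ.map_source hx.1)))

/-! ### The support function of `K` and equality in its triangle inequality -/

section Support
variable {n : ℕ} {K : Set (E n)}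

theorem frontier_interior_eq (hK : IsC2PlusBody K) : frontier (interior K) = frontier K := by
  rw [frontier, frontier, interior_interior,
    hK.convex.closure_interior_eq_closure_of_nonempty_interior ⟨0, hK.zero_mem_interior⟩]

open scoped Pointwise in
/-- `ρ⁰` is the support function of `K`. -/
theorem exists_inner_eq_rho0 (hK : IsC2PlusBody K) (v : E n) :
    ∃ p ∈ K, inner ℝ p v = rho0 K v ∧ ∀ q ∈ K, inner ℝ q v ≤ rho0 K v := by
  have h0 : (0 : E n) ∈ K := interior_subset hK.zero_mem_interior
  obtain ⟨p, hp, hmax⟩ := hK.isCompact.exists_isMaxOn ⟨0, h0⟩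
    (f := fun q : E n => inner ℝ q v) (by fun_prop)
  have hmax' : ∀ q ∈ K, inner ℝ q v ≤ inner ℝ p v := fun q hq => hmax hq
  have hp0 : 0 ≤ inner ℝ p v := by simpa using hmax' 0 h0
  have hset : {r : ℝ | 0 < r ∧ v ∈ r • polarSet K} = {r : ℝ | 0 < r ∧ inner ℝ p v ≤ r} := by
    ext r
    refine and_congr_right fun hr => ?_
    rw [Set.mem_smul_set_iff_inv_smul_mem₀ hr.ne']
    have key : ∀ q : E n, inner ℝ (r⁻¹ • v) q ≤ 1 ↔ inner ℝ q v ≤ r := fun q => by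
      rw [real_inner_smul_left, real_inner_comm, inv_mul_le_iff₀ hr, mul_one]
    exact ⟨fun h => (key p).1 (h p hp), fun h q hq => (key q).2 ((hmax' q hq).trans h)⟩
  have hval : rho0 K v = inner ℝ p v := by
    rw [rho0, gauge, hset]
    -- The infimum need not be attained: if the maximum is `0`, the set is `(0, ∞)`.
    refine (isGLB_iff_le_iff.2 fun b => ⟨?_, ?_⟩).csInf_eq ⟨inner ℝ p v + 1, by positivity, by simp⟩
    · rintro hb r ⟨-, hr⟩
      exact hb.trans hr
    · intro hb
      refine le_of_forall_pos_le_add fun ε hε => hb ⟨by positivity, by linarith⟩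
  exact ⟨p, hp, hval.symm, fun q hq => hval ▸ hmax' q hq⟩

theorem inner_le_rho0 (hK : IsC2PlusBody K) {q : E n} (hq : q ∈ K) (v : E n) :
    inner ℝ q v ≤ rho0 K v := by
  obtain ⟨_, -, -, h⟩ := exists_inner_eq_rho0 hK v
  exact h q hq

theorem rho0_nonneg (v : E n) : 0 ≤ rho0 K v := gauge_nonneg v

theorem rho0_zero : rho0 K (0 : E n) = 0 := gauge_zero

theorem rho0_smul {t : ℝ} (ht : 0 ≤ t) (v : E n) : rho0 K (t • v) = t * rho0 K v := by
  rw [rho0, gauge_smul_of_nonneg ht, smul_eq_mul, rho0]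

theorem rho0_add_le (hK : IsC2PlusBody K) (v w : E n) :
    rho0 K (v + w) ≤ rho0 K v + rho0 K w := by
  obtain ⟨p, hp, h, -⟩ := exists_inner_eq_rho0 hK (v + w)
  rw [← h, inner_add_right]
  exact add_le_add (inner_le_rho0 hK hp v) (inner_le_rho0 hK hp w)

theorem rho0_pos (hK : IsC2PlusBody K) {v : E n} (hv : v ≠ 0) : 0 < rho0 K v := by
  have h : ∀ᶠ t : ℝ in nhdsWithin 0 (Set.Ioi 0), t • v ∈ interior K := by
    have hc : ContinuousAt (fun t : ℝ => t • v) 0 := by fun_prop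
    refine (hc.eventually_mem ?_).filter_mono nhdsWithin_le_nhds
    rw [zero_smul]
    exact isOpen_interior.mem_nhds hK.zero_mem_interior
  obtain ⟨t, ht, ht0 : 0 < t⟩ := (h.and self_mem_nhdsWithin).exists
  refine lt_of_lt_of_le ?_ (inner_le_rho0 hK (interior_subset ht) v)
  rw [real_inner_smul_left, real_inner_self_eq_norm_sq]
  have := norm_pos_iff.2 hv
  positivity

theorem rho0_eq_zero (hK : IsC2PlusBody K) {v : E n} (h : rho0 K v = 0) : v = 0 := by
  by_contra hv
  exact (rho0_pos hK hv).ne' h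

theorem exists_rho0_le (hK : IsC2PlusBody K) :
    ∃ R : NNReal, ∀ v : E n, rho0 K v ≤ R * ‖v‖ := by
  obtain ⟨R, hR⟩ := hK.isCompact.isBounded.exists_norm_le
  refine ⟨R.toNNReal, fun v => ?_⟩
  obtain ⟨p, hp, h, -⟩ := exists_inner_eq_rho0 hK v
  rw [← h]
  refine (real_inner_le_norm p v).trans ?_
  gcongr
  exact (hR p hp).trans (Real.le_coe_toNNReal R)

theorem lipschitzWith_of_le_rho0 (hK : IsC2PlusBody K) :
    ∃ R : NNReal, ∀ (f : E n → ℝ) (s : Set (E n)),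
      (∀ x ∈ s, ∀ y ∈ s, f x - f y ≤ rho0 K (x - y)) → LipschitzOnWith R f s := by
  obtain ⟨R, hR⟩ := exists_rho0_le hK
  refine ⟨R, fun f s h => LipschitzOnWith.of_le_add_mul R fun x hx y hy => ?_⟩
  have h1 := h x hx y hy
  have h2 := hR (x - y)
  rw [dist_eq_norm]
  linarith

theorem rho0_sub_le (hK : IsC2PlusBody K) (v w : E n) :
    rho0 K v - rho0 K w ≤ rho0 K (v - w) := by
  have h := rho0_add_le hK (v - w) w
  rw [sub_add_cancel] at h
  linarith

theorem rho0_sub_triangle (hK : IsC2PlusBody K) (x y z : E n) :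
    rho0 K (x - z) ≤ rho0 K (x - y) + rho0 K (y - z) := by
  have h := rho0_add_le hK (x - y) (y - z)
  rwa [sub_add_sub_cancel] at h

theorem continuous_rho0 (hK : IsC2PlusBody K) : Continuous (rho0 K) := by
  obtain ⟨R, hR⟩ := lipschitzWith_of_le_rho0 hK
  exact (lipschitzOnWith_univ.1 (hR (rho0 K) Set.univ fun x _ y _ => rho0_sub_le hK x y)).continuous

theorem mem_frontier_of_inner_eq_rho0 (hK : IsC2PlusBody K) {p a : E n} (hp : p ∈ K) (ha : a ≠ 0)
    (h : inner ℝ p a = rho0 K a) : p ∈ frontier K := by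
  rw [hK.isCompact.isClosed.frontier_eq]
  refine ⟨hp, fun hpi => ?_⟩
  have h1 : ∀ᶠ t : ℝ in nhdsWithin 0 (Set.Ioi 0), p + t • a ∈ interior K := by
    have hc : ContinuousAt (fun t : ℝ => p + t • a) 0 := by fun_prop
    refine (hc.eventually_mem ?_).filter_mono nhdsWithin_le_nhds
    rw [zero_smul, add_zero]
    exact isOpen_interior.mem_nhds hpi
  obtain ⟨t, ht, ht0 : 0 < t⟩ := (h1.and self_mem_nhdsWithin).exists
  have h2 := inner_le_rho0 hK (interior_subset ht) a
  rw [inner_add_left, h, real_inner_smul_left, real_inner_self_eq_norm_sq] at h2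
  have := norm_pos_iff.2 ha
  have : 0 < t * ‖a‖ ^ 2 := by positivity
  linarith

/-- A support direction at a boundary point is a nonnegative multiple of the outward normal. -/
theorem sameRay_gradient_of_inner_eq_rho0 (hK : IsC2PlusBody K) {U : Set (E n)} {φ : E n → ℝ}
    (hφ : IsDefiningFunctionOn (interior K) U φ) {p a : E n} (hpU : p ∈ U)
    (hpf : p ∈ frontier K) (h : inner ℝ p a = rho0 K a) :
    SameRay ℝ a (gradient φ p) := by
  obtain ⟨hU, hC, hdef⟩ := hφ
  have hd : DifferentiableAt ℝ φ p := (hC.contDiffAt (hU.mem_nhds hpU)).differentiableAt (by norm_num)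
  have hφp : φ p = 0 := (hdef p hpU).2.2.1 (by rwa [frontier_interior_eq hK])
  set g := gradient φ p with hg
  have hgw : ∀ w, fderiv ℝ φ p w = inner ℝ g w := fun w => by
    rw [hg, gradient, InnerProductSpace.toDual_symm_apply]
  have hgne : g ≠ 0 := fun h0 => (hdef p hpU).1 (by ext w; simp [hgw, h0])
  -- A direction with `⟪g, w⟫ < 0` enters `K` from `p`, so it cannot increase the linear functional
  -- maximized at `p`.
  have key : ∀ w : E n, inner ℝ g w < 0 → inner ℝ w a ≤ 0 := by
    intro w hw
    have hline : HasDerivAt (fun t : ℝ => φ (p + t • w)) (inner ℝ g w) 0 := by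
      have h1 : HasDerivAt (fun t : ℝ => p + t • w) w 0 := by
        simpa using ((hasDerivAt_id (0 : ℝ)).smul_const w).const_add p
      have h2 : HasFDerivAt φ (fderiv ℝ φ p) (p + (0 : ℝ) • w) := by simpa using hd.hasFDerivAt
      simpa [hgw, Function.comp_def] using h2.comp_hasDerivAt (0 : ℝ) h1
    have hneg : ∀ᶠ t : ℝ in nhdsWithin 0 (Set.Ioi 0), φ (p + t • w) < 0 := by
      have h1 := (hline.tendsto_slope_zero_right).eventually (gt_mem_nhds hw)
      filter_upwards [h1, self_mem_nhdsWithin] with t ht ht0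
      have ht0' : (0 : ℝ) < t := ht0
      simp only [zero_add, zero_smul, add_zero, hφp, sub_zero, smul_eq_mul] at ht
      by_contra hcon
      push Not at hcon
      have : 0 ≤ t⁻¹ * φ (p + t • w) := by positivity
      linarith
    have hUe : ∀ᶠ t : ℝ in nhdsWithin 0 (Set.Ioi 0), p + t • w ∈ U := by
      have hc : ContinuousAt (fun t : ℝ => p + t • w) 0 := by fun_prop
      refine (hc.eventually_mem ?_).filter_mono nhdsWithin_le_nhds
      rw [zero_smul, add_zero]
      exact hU.mem_nhds hpU
    obtain ⟨t, ⟨ht, htU⟩, ht0 : 0 < t⟩ := ((hneg.and hUe).and self_mem_nhdsWithin).exists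
    have hmem := interior_subset ((hdef _ htU).2.1.2 ht)
    have h2 := inner_le_rho0 hK hmem a
    rw [inner_add_left, h, real_inner_smul_left] at h2
    by_contra hcon
    push Not at hcon
    have : 0 < t * inner ℝ w a := by positivity
    linarith
  have hg2 : 0 < ‖g‖ ^ 2 := by have := norm_pos_iff.2 hgne; positivity
  have hnn : 0 ≤ inner ℝ a g := by
    have h1 := key (-g) (by rw [inner_neg_right, real_inner_self_eq_norm_sq]; linarith)
    rw [inner_neg_left, real_inner_comm] at h1
    linarith
  have hsq : ‖a‖ ^ 2 * ‖g‖ ^ 2 ≤ (inner ℝ a g) ^ 2 := by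
    refine le_of_forall_pos_le_add fun ε hε => ?_
    set c := inner ℝ a g with hc
    have hgc : inner ℝ g a = c := real_inner_comm _ _
    have hδ : 0 < ε / (c + 1) := by positivity
    -- The test vector is a multiple of the component of `a` orthogonal to `g`, tilted inward. As
    -- the tilt tends to `0` this gives equality in Cauchy–Schwarz; `c + 1` avoids dividing by `c =
    -- 0`.
    have h1 := key (‖g‖ ^ 2 • a - (c + ε / (c + 1)) • g) (by
      rw [inner_sub_right, real_inner_smul_right, real_inner_smul_right,
        real_inner_self_eq_norm_sq, hgc]
      have : 0 < (ε / (c + 1)) * ‖g‖ ^ 2 := by positivity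
      linarith)
    rw [inner_sub_left, real_inner_smul_left, real_inner_smul_left, real_inner_self_eq_norm_sq,
      hgc] at h1
    have h2 : ε / (c + 1) * c ≤ ε := by
      rw [div_mul_eq_mul_div, div_le_iff₀ (by positivity)]
      nlinarith
    nlinarith
  have heq : inner ℝ a g = ‖a‖ * ‖g‖ :=
    le_antisymm (real_inner_le_norm a g)
      (abs_le_of_sq_le_sq' (by nlinarith) hnn).2
  rw [sameRay_iff_norm_smul_eq]
  exact (inner_eq_norm_mul_iff_real.1 heq).symm

/-- A maximizer for `a + b` also supports both `a` and `b`, which are therefore nonnegative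
multiples of the one normal there. -/
theorem sameRay_of_rho0_add_eq (hK : IsC2PlusBody K) {a b : E n}
    (h : rho0 K (a + b) = rho0 K a + rho0 K b) : SameRay ℝ a b := by
  rcases eq_or_ne a 0 with rfl | ha
  · exact SameRay.zero_left b
  obtain ⟨p, hp, hpab, -⟩ := exists_inner_eq_rho0 hK (a + b)
  rw [inner_add_right, h] at hpab
  have h1 := inner_le_rho0 hK hp a
  have h2 := inner_le_rho0 hK hp b
  have hpa : inner ℝ p a = rho0 K a := by linarith
  have hpb : inner ℝ p b = rho0 K b := by linarith
  have hpf := mem_frontier_of_inner_eq_rho0 hK hp ha hpa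
  obtain ⟨U, φ, hpU, hφ⟩ :=
    exists_isDefiningFunctionOn hK.classC2 (by rwa [frontier_interior_eq hK] : p ∈ _)
  refine (sameRay_gradient_of_inner_eq_rho0 hK hφ hpU hpf hpa).trans
    (sameRay_gradient_of_inner_eq_rho0 hK hφ hpU hpf hpb).symm fun h0 => ?_
  refine absurd ?_ (hφ.2.2 p hpU).1
  rwa [gradient, map_eq_zero_iff _ (InnerProductSpace.toDual ℝ (E n)).symm.injective] at h0

end Support

/-! ### Positive curvatures and the second derivative -/

/-- The infimum of the Rayleigh quotient is an eigenvalue. -/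
theorem inner_pos_of_eigenvalue_pos {W : Type*} [NormedAddCommGroup W] [InnerProductSpace ℝ W]
    [FiniteDimensional ℝ W] {T : W →ₗ[ℝ] W} (hT : T.IsSymmetric)
    (hpos : ∀ μ : ℝ, Module.End.HasEigenvalue T μ → 0 < μ) {v : W} (hv : v ≠ 0) :
    0 < inner ℝ (T v) v := by
  have : Nontrivial W := ⟨v, 0, hv⟩
  have h := hpos _ hT.hasEigenvalue_iInf_of_finiteDimensional
  have hbdd : BddBelow (Set.range fun x : {x : W // x ≠ 0} =>
      RCLike.re (inner ℝ (T x) (x : W)) / ‖(x : W)‖ ^ 2) := by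
    refine ⟨-‖LinearMap.toContinuousLinearMap T‖, ?_⟩
    rintro _ ⟨x, rfl⟩
    have hx : 0 < ‖(x : W)‖ := norm_pos_iff.2 x.2
    have h1 := (LinearMap.toContinuousLinearMap T).le_opNorm (x : W)
    have h2 := abs_real_inner_le_norm (T x) (x : W)
    rw [LinearMap.coe_toContinuousLinearMap'] at h1
    simp only [RCLike.re_to_real]
    rw [le_div_iff₀ (by positivity)]
    have h3 := neg_abs_le (inner ℝ (T x) (x : W))
    nlinarith
  have h2 := ciInf_le hbdd ⟨v, hv⟩
  have h3 : 0 < RCLike.re (inner ℝ (T v) v) / ‖v‖ ^ 2 := lt_of_lt_of_le (by exact_mod_cast h) h2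
  have hv' : 0 < ‖v‖ ^ 2 := by have := norm_pos_iff.2 hv; positivity
  simpa using (div_pos_iff_of_pos_right hv').1 h3

/-- If all principal curvatures at `x` are positive, the second fundamental form at `x` is positive
definite. -/
theorem snd_fderiv_pos {n : ℕ} {O U : Set (E n)} {φ : E n → ℝ} {x : E n}
    (hcurv : ∀ κ, IsPrincipalCurvature O x κ → 0 < κ)
    (hφ : IsDefiningFunctionOn O U φ) (hx : x ∈ U) {v : E n} (hv : v ≠ 0)
    (htan : fderiv ℝ φ x v = 0) : 0 < fderiv ℝ (fderiv ℝ φ) x v v := by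
  have hgne : fderiv ℝ φ x ≠ 0 := (hφ.2.2 x hx).1
  have hgn : 0 < ‖fderiv ℝ φ x‖ := norm_pos_iff.2 hgne
  set B := fderiv ℝ (fderiv ℝ φ) x with hB
  have hsymm : ∀ a b, B a b = B b a := by
    have h := (hφ.2.1.contDiffAt (hφ.1.mem_nhds hx)).isSymmSndFDerivAt (by simp)
    exact fun a b => h a b
  let W : Submodule ℝ (E n) := LinearMap.ker (fderiv ℝ φ x : E n →ₗ[ℝ] ℝ)
  have hW : ∀ w : W, fderiv ℝ φ x w = 0 := fun w => w.2
  -- The operator on the tangent space that represents `B`; its eigenvalues are principal curvatures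
  -- times `‖Dφ(x)‖`.
  let T : W →ₗ[ℝ] W :=
    { toFun := fun w =>
        W.orthogonalProjectionOnto ((InnerProductSpace.toDual ℝ (E n)).symm (B w))
      map_add' := fun a b => by simp only [Submodule.coe_add, map_add]
      map_smul' := fun c a => by simp }
  have hTi : ∀ a b : W, inner ℝ (T a) b = B a b := by
    intro a b
    have h1 : T a = W.orthogonalProjectionOnto ((InnerProductSpace.toDual ℝ (E n)).symm (B a)) := rfl
    rw [h1, Submodule.inner_orthogonalProjectionOnto_eq_of_mem_right,
      InnerProductSpace.toDual_symm_apply]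
  have hT : T.IsSymmetric := fun a b => by
    rw [hTi, real_inner_comm, hTi, hsymm]
  have h := inner_pos_of_eigenvalue_pos hT ?_ (v := ⟨v, htan⟩) (fun h => hv (congrArg Subtype.val h))
  · rwa [hTi] at h
  · intro μ hμ
    obtain ⟨e, he⟩ := hμ.exists_hasEigenvector
    have h1 : 0 < μ / ‖fderiv ℝ φ x‖ := by
      refine hcurv _ ⟨U, φ, hx, hφ, e, fun h => he.2 (Subtype.ext h), hW e, fun w hw => ?_⟩
      rw [← hB, ← hTi e ⟨w, hw⟩, he.apply_eq_smul, real_inner_smul_left, Submodule.coe_inner]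
      ring
    exact (div_pos_iff_of_pos_right hgn).1 h1

/-- If a `C²` function vanishes along a segment, so do its first and second derivatives. -/
theorem fderiv_eq_zero_of_line {F : Type*} [NormedAddCommGroup F] [NormedSpace ℝ F] {U : Set F}
    {φ : F → ℝ} (hU : IsOpen U) (hC : ContDiffOn ℝ 2 φ U) {x v : F} (hxU : x ∈ U)
    (h0 : ∀ᶠ t : ℝ in nhds 0, φ (x + t • v) = 0) :
    fderiv ℝ φ x v = 0 ∧ fderiv ℝ (fderiv ℝ φ) x v v = 0 := by
  have hline : ∀ t : ℝ, HasDerivAt (fun t : ℝ => x + t • v) v t := fun t => by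
    simpa using ((hasDerivAt_id t).smul_const v).const_add x
  have hx0 : x + (0 : ℝ) • v = x := by rw [zero_smul, add_zero]
  have hUe : ∀ᶠ t : ℝ in nhds 0, x + t • v ∈ U := by
    refine (hline 0).continuousAt.eventually_mem ?_
    rw [hx0]
    exact hU.mem_nhds hxU
  have h1 : ∀ᶠ t : ℝ in nhds 0, fderiv ℝ φ (x + t • v) v = 0 := by
    filter_upwards [h0.eventually_nhds, hUe] with t ht htU
    have hd : HasFDerivAt φ (fderiv ℝ φ (x + t • v)) (x + t • v) :=
      ((hC.contDiffAt (hU.mem_nhds htU)).differentiableAt (by norm_num)).hasFDerivAt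
    have h2 := hd.comp_hasDerivAt t (hline t)
    exact h2.unique ((hasDerivAt_const t (0 : ℝ)).congr_of_eventuallyEq ht)
  refine ⟨by simpa only [hx0] using h1.self_of_nhds, ?_⟩
  have hd2 : HasFDerivAt (fderiv ℝ φ) (fderiv ℝ (fderiv ℝ φ) x) (x + (0 : ℝ) • v) := by
    rw [hx0]
    exact (((hC.contDiffAt (hU.mem_nhds hxU)).fderiv_right (m := 1)
      (by norm_num)).differentiableAt (by norm_num)).hasFDerivAt
  have h2 : HasDerivAt (fun t : ℝ => fderiv ℝ φ (x + t • v)) (fderiv ℝ (fderiv ℝ φ) x v) 0 :=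
    hd2.comp_hasDerivAt (0 : ℝ) (hline 0)
  have h3 : HasDerivAt (fun t : ℝ => fderiv ℝ φ (x + t • v) v) (fderiv ℝ (fderiv ℝ φ) x v v) 0 :=
    (ContinuousLinearMap.apply ℝ ℝ v).hasFDerivAt.comp_hasDerivAt (0 : ℝ) h2
  have h4 : HasDerivAt (fun t : ℝ => fderiv ℝ φ (x + t • v) v) 0 0 :=
    (hasDerivAt_const (0 : ℝ) (0 : ℝ)).congr_of_eventuallyEq h1
  exact h3.unique h4

/-! ### Strict convexity of `K` and differentiability of `ρ⁰` -/

section Support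
variable {n : ℕ} {K : Set (E n)}

/-- Two maximizers would span a segment in `∂K`, along which the second derivative of a defining
function vanishes, against positive definiteness. -/
theorem eq_of_inner_eq_rho0 (hK : IsC2PlusBody K) {p q a : E n} (hp : p ∈ K) (hq : q ∈ K)
    (ha : a ≠ 0) (hpa : inner ℝ p a = rho0 K a) (hqa : inner ℝ q a = rho0 K a) : p = q := by
  by_contra hpq
  obtain ⟨v, hv⟩ : ∃ v, v = q - p := ⟨_, rfl⟩
  have hvne : v ≠ 0 := hv ▸ sub_ne_zero.2 (Ne.symm hpq)
  obtain ⟨x, hx⟩ : ∃ x, x = p + (1 / 2 : ℝ) • v := ⟨_, rfl⟩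
  have hfr : ∀ t : ℝ, |t| ≤ 1 / 2 → x + t • v ∈ frontier K := by
    intro t ht
    have ht' := abs_le.1 ht
    have he : x + t • v = (1 / 2 - t) • p + (1 / 2 + t) • q := by rw [hx, hv]; module
    have hmem : x + t • v ∈ K := by
      rw [he]; exact hK.convex hp hq (by linarith) (by linarith) (by ring)
    refine mem_frontier_of_inner_eq_rho0 hK hmem ha ?_
    rw [he, inner_add_left, real_inner_smul_left, real_inner_smul_left, hpa, hqa]
    ring
  have hxf : x ∈ frontier K := by simpa using hfr 0 (by norm_num)
  obtain ⟨U, φ, hxU, hφ⟩ :=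
    exists_isDefiningFunctionOn hK.classC2 (by rwa [frontier_interior_eq hK] : x ∈ _)
  have hUe : ∀ᶠ t : ℝ in nhds 0, x + t • v ∈ U := by
    have hc : ContinuousAt (fun t : ℝ => x + t • v) 0 := by fun_prop
    refine hc.eventually_mem ?_
    rw [zero_smul, add_zero]
    exact hφ.1.mem_nhds hxU
  have hsmall : ∀ᶠ t : ℝ in nhds 0, |t| ≤ 1 / 2 := by
    have : ∀ᶠ t : ℝ in nhds 0, |t| < 1 / 2 :=
      ContinuousAt.eventually_lt (f := fun t : ℝ => |t|) (g := fun _ => (1 / 2 : ℝ)) (by fun_prop)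
        (by fun_prop) (by norm_num)
    exact this.mono fun t ht => ht.le
  obtain ⟨htan, h2⟩ := fderiv_eq_zero_of_line hφ.1 hφ.2.1 hxU (v := v) <| by
    filter_upwards [hUe, hsmall] with t ht ht'
    exact (hφ.2.2 _ ht).2.2.1 ((frontier_interior_eq hK).symm ▸ hfr t ht')
  exact (snd_fderiv_pos (hK.curvature_pos x hxf) hφ hxU hvne htan).ne' h2

/-- The increment `ρ⁰(w) - ρ⁰(v)` lies between `⟪p, w - v⟫` and `⟪q, w - v⟫` with `q` a maximizer
for `w`; compactness and uniqueness of `p` force `q` close to `p`. -/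
theorem differentiableAt_rho0 (hK : IsC2PlusBody K) {v : E n} (hv : v ≠ 0) :
    ∃ p ∈ K, HasFDerivAt (rho0 K) (innerSL ℝ p) v := by
  obtain ⟨p, hp, hpv, -⟩ := exists_inner_eq_rho0 hK v
  refine ⟨p, hp, HasFDerivAt.of_isLittleO (Asymptotics.isLittleO_iff.2 fun ε hε => ?_)⟩
  have hev : ∀ᶠ w in nhds v, ∀ q ∈ K \ Metric.ball p ε, inner ℝ q w < rho0 K w := by
    refine (hK.isCompact.diff Metric.isOpen_ball).eventually_forall_of_forall_eventually ?_
    intro q hq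
    have hne : q ≠ p := by
      rintro rfl
      exact hq.2 (Metric.mem_ball_self hε)
    have hlt : inner ℝ q v < rho0 K v := lt_of_le_of_ne (inner_le_rho0 hK hq.1 v)
      fun h => hne (eq_of_inner_eq_rho0 hK hq.1 hp hv h hpv)
    have hc := continuous_rho0 hK
    exact ContinuousAt.eventually_lt (f := fun z : E n × E n => inner ℝ z.2 z.1)
      (g := fun z : E n × E n => rho0 K z.1) (by fun_prop) (by fun_prop) hlt
  filter_upwards [hev] with w hw
  obtain ⟨q, hq, hqw, -⟩ := exists_inner_eq_rho0 hK w
  have hqp : ‖q - p‖ ≤ ε := by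
    by_contra hcon
    refine (hw q ⟨hq, fun hb => hcon ?_⟩).ne hqw
    rw [← dist_eq_norm]; exact (Metric.mem_ball.1 hb).le
  have h1 := inner_le_rho0 hK hp w
  have h2 := inner_le_rho0 hK hq v
  have h3 : inner ℝ (q - p) (w - v) ≤ ε * ‖w - v‖ :=
    (real_inner_le_norm _ _).trans (by gcongr)
  simp only [inner_sub_left, inner_sub_right] at h3
  rw [innerSL_apply_apply, inner_sub_right, Real.norm_eq_abs, abs_le]
  constructor
  · have : 0 ≤ ε * ‖w - v‖ := by positivity
    linarith
  · linarith

/-- The inequality for all `w` puts `p` in `K` by separation; equality at `v ≠ 0` puts it on `∂K`.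
-/
theorem rho_eq_one (hK : IsC2PlusBody K) {p v : E n} (hle : ∀ w, inner ℝ p w ≤ rho0 K w)
    (hv : v ≠ 0) (hge : rho0 K v ≤ inner ℝ p v) : rho K p = 1 := by
  have hpK : p ∈ K := by
    by_contra hp
    obtain ⟨f, u, hfu, hu⟩ := geometric_hahn_banach_closed_point hK.convex hK.isCompact.isClosed hp
    obtain ⟨w, hw⟩ : ∃ w : E n, ∀ q, f q = inner ℝ q w :=
      ⟨(InnerProductSpace.toDual ℝ (E n)).symm f, fun q => by
        rw [real_inner_comm, InnerProductSpace.toDual_symm_apply]⟩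
    obtain ⟨q, hq, hqw, -⟩ := exists_inner_eq_rho0 hK w
    have h1 := hfu q hq
    have h2 := hle w
    rw [hw] at h1 hu
    linarith
  rw [rho, gauge_eq_one_iff_mem_frontier hK.convex (mem_interior_iff_mem_nhds.1 hK.zero_mem_interior)]
  exact mem_frontier_of_inner_eq_rho0 hK hpK hv (le_antisymm (hle v) hge)

end Support

/-! ### The distance `d`, the transport set and the bounds for `u_S` -/

section Distance
variable {n : ℕ} {K Ω S : Set (E n)}

theorem frontier_nonempty (hn : 1 ≤ n) (hΩ : IsC2Domain Ω) : (frontier Ω).Nonempty := by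
  have : Nonempty (Fin n) := ⟨⟨0, hn⟩⟩
  refine nonempty_frontier_iff.2 ⟨hΩ.isConnected.nonempty, fun h => ?_⟩
  exact NormedSpace.unbounded_univ ℝ (E n) (h ▸ hΩ.isBounded)

theorem isCompact_closure (hΩ : IsC2Domain Ω) : IsCompact (closure Ω) :=
  Metric.isCompact_of_isClosed_isBounded isClosed_closure hΩ.isBounded.closure

theorem isCompact_frontier (hΩ : IsC2Domain Ω) : IsCompact (frontier Ω) :=
  (isCompact_closure hΩ).of_isClosed_subset isClosed_frontier frontier_subset_closure

theorem rho0_segment {x y w : E n} (hw : w ∈ segment ℝ y x) :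
    rho0 K (x - y) = rho0 K (x - w) + rho0 K (w - y) := by
  obtain ⟨a, b, ha, hb, hab, rfl⟩ := hw
  have h1 : x - (a • y + b • x) = a • (x - y) := by
    obtain rfl : a = 1 - b := by linarith
    module
  have h2 : a • y + b • x - y = b • (x - y) := by
    obtain rfl : a = 1 - b := by linarith
    module
  rw [h1, h2, rho0_smul ha, rho0_smul hb, ← add_mul, hab, one_mul]

theorem minkDist_le {y : E n} (hy : y ∈ frontier Ω) (x : E n) : minkDist K Ω x ≤ rho0 K (x - y) :=
  csInf_le ⟨0, by rintro _ ⟨z, -, rfl⟩; exact rho0_nonneg _⟩ ⟨y, hy, rfl⟩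

theorem proj_nonempty (hK : IsC2PlusBody K) (hF : IsCompact (frontier Ω))
    (hFn : (frontier Ω).Nonempty) (x : E n) : (proj K Ω x).Nonempty := by
  have hc := continuous_rho0 hK
  obtain ⟨y, hy, h, -⟩ := hF.exists_sInf_image_eq_and_le hFn
    (f := fun y => rho0 K (x - y)) (by fun_prop)
  exact ⟨y, hy, h⟩

theorem minkDist_nonneg (hK : IsC2PlusBody K) (hF : IsCompact (frontier Ω))
    (hFn : (frontier Ω).Nonempty) (x : E n) : 0 ≤ minkDist K Ω x := by
  obtain ⟨y, -, h⟩ := proj_nonempty hK hF hFn x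
  rw [h]; exact rho0_nonneg _

theorem minkDist_sub_le (hK : IsC2PlusBody K) (hF : IsCompact (frontier Ω))
    (hFn : (frontier Ω).Nonempty) (x z : E n) :
    minkDist K Ω x - minkDist K Ω z ≤ rho0 K (x - z) := by
  obtain ⟨y, hy, h⟩ := proj_nonempty hK hF hFn z
  have h1 := minkDist_le (K := K) hy x
  have h2 := rho0_sub_triangle hK x z y
  linarith

theorem continuous_minkDist (hK : IsC2PlusBody K) (hF : IsCompact (frontier Ω))
    (hFn : (frontier Ω).Nonempty) : Continuous (minkDist K Ω) := by
  obtain ⟨R, hR⟩ := lipschitzWith_of_le_rho0 hK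
  exact (lipschitzOnWith_univ.1
    (hR _ Set.univ fun x _ y _ => minkDist_sub_le hK hF hFn x y)).continuous

theorem minkDist_eq_zero_iff (hK : IsC2PlusBody K) (hF : IsCompact (frontier Ω))
    (hFn : (frontier Ω).Nonempty) {x : E n} : minkDist K Ω x = 0 ↔ x ∈ frontier Ω := by
  constructor
  · intro h
    obtain ⟨y, hy, h'⟩ := proj_nonempty hK hF hFn x
    rwa [sub_eq_zero.1 (rho0_eq_zero hK (h'.symm.trans h))]
  · intro h
    refine le_antisymm ?_ (minkDist_nonneg hK hF hFn x)
    have := minkDist_le (K := K) h x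
    rwa [sub_self, rho0_zero] at this

theorem minkDist_segment (hK : IsC2PlusBody K) (hF : IsCompact (frontier Ω))
    (hFn : (frontier Ω).Nonempty) {z y w : E n} (hy : y ∈ proj K Ω z) (hw : w ∈ segment ℝ y z) :
    minkDist K Ω z = minkDist K Ω w + rho0 K (z - w) ∧ minkDist K Ω w = rho0 K (w - y) := by
  have h1 := rho0_segment (K := K) hw
  have h2 := hy.2
  have h3 := minkDist_le (K := K) hy.1 w
  have h4 := minkDist_sub_le hK hF hFn z w
  constructor <;> linarith

/-- The chain `d(z) ≤ ρ⁰(z - y) ≤ ρ⁰(z - w) + ρ⁰(w - y) = d(z)` is an equality, and strict convexity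
of `K⁰` aligns the three points. -/
theorem mem_proj_of_minkDist_eq_add (hK : IsC2PlusBody K) {z y w : E n} (hy : y ∈ proj K Ω w)
    (h : minkDist K Ω z = minkDist K Ω w + rho0 K (z - w)) :
    y ∈ proj K Ω z ∧ w ∈ segment ℝ y z := by
  have h1 := minkDist_le (K := K) hy.1 z
  have h2 := rho0_sub_triangle hK z w y
  have h3 := hy.2
  refine ⟨⟨hy.1, by linarith⟩, mem_segment_iff_sameRay.2 ?_⟩
  refine (sameRay_of_rho0_add_eq hK ?_).symm
  rw [sub_add_sub_cancel]
  linarith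

theorem exists_mem_frontier_segment {x w : E n} (hx : x ∈ closure Ω) (hw : w ∉ closure Ω) :
    ∃ q ∈ frontier Ω, q ∈ segment ℝ x w := by
  by_contra hcon
  push Not at hcon
  have hpre : IsPreconnected (segment ℝ x w) := (convex_segment x w).isPreconnected
  have hsub : segment ℝ x w ⊆ (closure Ω)ᶜ := by
    refine subset_of_disjoint_frontier hpre isClosed_closure.isOpen_compl
      ⟨w, right_mem_segment ℝ x w, hw⟩ (Set.disjoint_left.2 fun q hq hqf => ?_)
    rw [frontier_compl] at hqf
    exact hcon q (frontier_closure_subset hqf) hq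
  exact hsub (left_mem_segment ℝ x w) hx

/-- A point `w` outside would leave a boundary point `q` between `w` and `z`, and `d(z) ≤ ρ⁰(z - q)`
then forces `q = w`. -/
theorem segment_proj_subset_closure (hK : IsC2PlusBody K) (hF : IsCompact (frontier Ω))
    (hFn : (frontier Ω).Nonempty) {z y : E n} (hz : z ∈ closure Ω) (hy : y ∈ proj K Ω z) :
    segment ℝ y z ⊆ closure Ω := by
  intro w hw
  by_contra hwc
  obtain ⟨q, hq, hqs⟩ := exists_mem_frontier_segment hz hwc
  rw [segment_symm] at hqs
  have h1 := rho0_segment (K := K) hqs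
  have h2 := minkDist_le (K := K) hq z
  obtain ⟨h3, h4⟩ := minkDist_segment hK hF hFn hy hw
  have h5 : rho0 K (q - w) = 0 :=
    le_antisymm (by linarith [minkDist_nonneg hK hF hFn w]) (rho0_nonneg _)
  rw [sub_eq_zero.1 (rho0_eq_zero hK h5)] at hq
  exact hwc (frontier_subset_closure hq)

/-- This eliminates `S*` and `Π`. For the converse, an admissible `z` with `d(z)` maximal belongs to
`S*`: any point of `S` whose projection segment contains it is admissible too. -/
theorem mem_transportSet_iff (hK : IsC2PlusBody K) (hF : IsCompact (frontier Ω))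
    (hFn : (frontier Ω).Nonempty) (hS : IsCompact S) {x : E n} :
    x ∈ transportSet K Ω S ↔ ∃ z ∈ S, minkDist K Ω z = minkDist K Ω x + rho0 K (z - x) := by
  simp only [transportSet, Set.mem_iUnion, exists_prop]
  constructor
  · rintro ⟨z, hz, y, hy, hx⟩
    exact ⟨z, hz.1, (minkDist_segment hK hF hFn hy hx).1⟩
  · intro hex
    have hd := continuous_minkDist hK hF hFn
    have hr := continuous_rho0 hK
    have hC : IsCompact {z | z ∈ S ∧ minkDist K Ω z = minkDist K Ω x + rho0 K (z - x)} :=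
      hS.inter_right (isClosed_eq hd (by fun_prop))
    obtain ⟨z', ⟨hz'S, hz'⟩, hmax⟩ := hC.exists_isMaxOn hex hd.continuousOn
    obtain ⟨y', hy'⟩ := proj_nonempty hK hF hFn x
    obtain ⟨hy'z, hxs⟩ := mem_proj_of_minkDist_eq_add hK hy' hz'
    refine ⟨z', ⟨hz'S, fun z hz y hy hzs => ?_⟩, y', hy'z, hxs⟩
    have h1 := (minkDist_segment hK hF hFn hy hzs).1
    have h2 := rho0_sub_triangle hK z z' x
    have h3 := minkDist_sub_le hK hF hFn z x
    have h4 : minkDist K Ω z ≤ minkDist K Ω z' := hmax ⟨hz, by linarith⟩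
    exact sub_eq_zero.1 (rho0_eq_zero hK (le_antisymm (by linarith) (rho0_nonneg _)))

theorem transportSet_subset_closure (hK : IsC2PlusBody K) (hF : IsCompact (frontier Ω))
    (hFn : (frontier Ω).Nonempty) (hSΩ : S ⊆ closure Ω) : transportSet K Ω S ⊆ closure Ω := by
  intro x hx
  simp only [transportSet, Set.mem_iUnion, exists_prop] at hx
  obtain ⟨z, hz, y, hy, hx⟩ := hx
  exact segment_proj_subset_closure hK hF hFn (hSΩ hz.1) hy hx

/-- The set is the projection of a compact set of pairs `(x, z)`. -/
theorem isClosed_transportSet (hK : IsC2PlusBody K) (hΩ : IsC2Domain Ω)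
    (hFn : (frontier Ω).Nonempty) (hS : IsCompact S) (hSΩ : S ⊆ closure Ω) :
    IsClosed (transportSet K Ω S) := by
  have hF := isCompact_frontier hΩ
  have hd := continuous_minkDist hK hF hFn
  have hr := continuous_rho0 hK
  have hC : IsCompact ((closure Ω ×ˢ S) ∩
      {p : E n × E n | minkDist K Ω p.2 = minkDist K Ω p.1 + rho0 K (p.2 - p.1)}) :=
    ((isCompact_closure hΩ).prod hS).inter_right (isClosed_eq (by fun_prop) (by fun_prop))
  convert (hC.image continuous_fst).isClosed
  ext x
  constructor
  · intro hx
    obtain ⟨z, hz, h⟩ := (mem_transportSet_iff hK hF hFn hS).1 hx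
    exact ⟨(x, z), ⟨⟨transportSet_subset_closure hK hF hFn hSΩ hx, hz⟩, h⟩, rfl⟩
  · rintro ⟨⟨x, z⟩, ⟨⟨-, hz⟩, h⟩, rfl⟩
    exact (mem_transportSet_iff hK hF hFn hS).2 ⟨z, hz, h⟩

theorem subset_transportSet (hK : IsC2PlusBody K) (hF : IsCompact (frontier Ω))
    (hFn : (frontier Ω).Nonempty) (hS : IsCompact S) : S ⊆ transportSet K Ω S := fun x hx =>
  (mem_transportSet_iff hK hF hFn hS).2 ⟨x, hx, by rw [sub_self, rho0_zero, add_zero]⟩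

theorem exists_uS_eq (hK : IsC2PlusBody K) (hF : IsCompact (frontier Ω))
    (hFn : (frontier Ω).Nonempty) (hS : IsCompact S) (x : E n) :
    (∃ z ∈ S ∪ frontier Ω, uS K Ω S x = minkDist K Ω z - rho0 K (z - x)) ∧
      ∀ z ∈ S ∪ frontier Ω, minkDist K Ω z - rho0 K (z - x) ≤ uS K Ω S x := by
  have hd := continuous_minkDist hK hF hFn
  have hr := continuous_rho0 hK
  obtain ⟨z, hz, h, hle⟩ := (hS.union hF).exists_sSup_image_eq_and_ge hFn.inr
    (f := fun z => minkDist K Ω z - rho0 K (z - x)) (by fun_prop)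
  exact ⟨⟨z, hz, h⟩, fun w hw => (hle w hw).trans h.ge⟩

theorem uS_sub_le (hK : IsC2PlusBody K) (hF : IsCompact (frontier Ω))
    (hFn : (frontier Ω).Nonempty) (hS : IsCompact S) (x y : E n) :
    uS K Ω S x - uS K Ω S y ≤ rho0 K (x - y) := by
  obtain ⟨z, hz, h⟩ := (exists_uS_eq hK hF hFn hS x).1
  have h1 := (exists_uS_eq hK hF hFn hS y).2 z hz
  have h2 := rho0_sub_triangle hK z x y
  linarith

theorem uS_le_minkDist (hK : IsC2PlusBody K) (hF : IsCompact (frontier Ω))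
    (hFn : (frontier Ω).Nonempty) (hS : IsCompact S) (x : E n) :
    uS K Ω S x ≤ minkDist K Ω x := by
  obtain ⟨z, hz, h⟩ := (exists_uS_eq hK hF hFn hS x).1
  have h1 := minkDist_sub_le hK hF hFn z x
  linarith

theorem uS_eq_minkDist_of_mem (hK : IsC2PlusBody K) (hF : IsCompact (frontier Ω))
    (hFn : (frontier Ω).Nonempty) (hS : IsCompact S) {x : E n} (hx : x ∈ S ∪ frontier Ω) :
    uS K Ω S x = minkDist K Ω x := by
  refine le_antisymm (uS_le_minkDist hK hF hFn hS x) ?_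
  have h := (exists_uS_eq hK hF hFn hS x).2 x hx
  rwa [sub_self, rho0_zero, sub_zero] at h

theorem uS_eq_minkDist_of_mem_transportSet (hK : IsC2PlusBody K) (hF : IsCompact (frontier Ω))
    (hFn : (frontier Ω).Nonempty) (hS : IsCompact S) {x : E n} (hx : x ∈ transportSet K Ω S) :
    uS K Ω S x = minkDist K Ω x := by
  refine le_antisymm (uS_le_minkDist hK hF hFn hS x) ?_
  obtain ⟨z, hz, h⟩ := (mem_transportSet_iff hK hF hFn hS).1 hx
  have h1 := (exists_uS_eq hK hF hFn hS x).2 z (Or.inl hz)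
  linarith

theorem isLip01_uS (hK : IsC2PlusBody K) (hF : IsCompact (frontier Ω))
    (hFn : (frontier Ω).Nonempty) (hS : IsCompact S) : IsLip01 K Ω (uS K Ω S) := by
  obtain ⟨R, hR⟩ := lipschitzWith_of_le_rho0 hK
  refine ⟨⟨(hR _ _ fun x _ y _ => uS_sub_le hK hF hFn hS x y).continuousOn, fun x y _ =>
    uS_sub_le hK hF hFn hS x y⟩, fun y hy => ?_⟩
  rw [uS_eq_minkDist_of_mem hK hF hFn hS (Or.inr hy)]
  exact (minkDist_eq_zero_iff hK hF hFn).2 hy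

theorem le_minkDist_of_isLip01 (hK : IsC2PlusBody K) (hF : IsCompact (frontier Ω))
    (hFn : (frontier Ω).Nonempty) {u : E n → ℝ} (hu : IsLip01 K Ω u) {x : E n}
    (hx : x ∈ closure Ω) : u x ≤ minkDist K Ω x := by
  obtain ⟨y, hy⟩ := proj_nonempty hK hF hFn x
  have h1 := hu.1.2 x y (by
    rw [segment_symm]; exact segment_proj_subset_closure hK hF hFn hx hy)
  rw [hu.2 y hy.1, sub_zero] at h1
  exact h1.trans hy.2.ge

/-- Either the segment `[x, z]` stays in the closure, or it has an initial piece in the closure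
ending on the boundary. -/
theorem segment_subset_or_exists_exit {x z : E n} (hF : IsCompact (frontier Ω))
    (hx : x ∈ closure Ω) : segment ℝ x z ⊆ closure Ω ∨
      ∃ q ∈ frontier Ω, q ∈ segment ℝ x z ∧ segment ℝ x q ⊆ closure Ω := by
  by_cases hsub : segment ℝ x z ⊆ closure Ω
  · exact Or.inl hsub
  refine Or.inr ?_
  obtain ⟨w, hw, hwc⟩ := Set.not_subset.1 hsub
  obtain ⟨q₀, hq₀, hq₀s⟩ := exists_mem_frontier_segment hx hwc
  have hmono : ∀ {a b : E n}, b ∈ segment ℝ x a → segment ℝ x b ⊆ segment ℝ x a := fun h =>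
    (convex_segment _ _).segment_subset (left_mem_segment ℝ _ _) h
  have hclosed : IsClosed (segment ℝ x z) := by
    rw [← convexHull_pair]
    exact ((Set.toFinite {x, z}).isCompact_convexHull (𝕜 := ℝ)).isClosed
  -- The boundary point of the segment nearest to `x` is the first one met from `x`.
  obtain ⟨q, ⟨hqf, hqs⟩, hmin⟩ := (hF.inter_right hclosed).exists_isMinOn
    ⟨q₀, hq₀, hmono hw hq₀s⟩ (f := fun q => dist x q) (by fun_prop)
  refine ⟨q, hqf, hqs, fun a ha => ?_⟩
  by_contra hac
  obtain ⟨q', hq', hq's⟩ := exists_mem_frontier_segment hx hac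
  have h1 : dist x q ≤ dist x q' := hmin ⟨hq', hmono hqs (hmono ha hq's)⟩
  have h2 := dist_add_dist_of_mem_segment hq's
  have h3 := dist_add_dist_of_mem_segment ha
  have h4 : dist q' a = 0 := le_antisymm (by linarith [dist_nonneg (x := a) (y := q)]) dist_nonneg
  rw [dist_eq_zero.1 h4] at hq'
  exact hac (frontier_subset_closure hq')

theorem uS_le_of_isLip01 (hK : IsC2PlusBody K) (hF : IsCompact (frontier Ω))
    (hFn : (frontier Ω).Nonempty) (hS : IsCompact S) {u : E n → ℝ} (hu : IsLip01 K Ω u)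
    (huS : ∀ x ∈ S, u x = minkDist K Ω x) {x : E n} (hx : x ∈ closure Ω) :
    uS K Ω S x ≤ u x := by
  obtain ⟨z, hz, h⟩ := (exists_uS_eq hK hF hFn hS x).1
  have huz : u z = minkDist K Ω z := by
    rcases hz with hz | hz
    · exact huS z hz
    · rw [hu.2 z hz, (minkDist_eq_zero_iff hK hF hFn).2 hz]
  rw [h]
  rcases segment_subset_or_exists_exit (z := z) hF hx with hsub | ⟨q, hq, hqs, hsub⟩
  · have h1 := hu.1.2 z x (by rwa [segment_symm])
    linarith
  -- At the exit point `u(q) = 0`, and `d(z) - ρ⁰(z - x) ≤ -ρ⁰(q - x) ≤ u(x)`.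
  · have h1 := hu.1.2 q x (by rwa [segment_symm])
    have h2 := rho0_segment (K := K) hqs
    have h3 := minkDist_le (K := K) hq z
    rw [hu.2 q hq] at h1
    linarith

end Distance

/-! ### Almost everywhere equality of derivatives, and tools for slopes -/

/-- Two functions that agree on a measurable set have the same derivative at almost every point of
the set where both are differentiable. -/
theorem ae_fderiv_eq_of_eqOn {F : Type*} [NormedAddCommGroup F] [NormedSpace ℝ F]
    [FiniteDimensional ℝ F] [MeasurableSpace F] [BorelSpace F] (μ : Measure F)
    [μ.IsAddHaarMeasure] [Nontrivial F] {f g : F → ℝ} {A : Set F} (hA : MeasurableSet A)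
    (hfg : ∀ x ∈ A, f x = g x) :
    ∀ᵐ x ∂μ.restrict A, DifferentiableAt ℝ f x → DifferentiableAt ℝ g x →
      fderiv ℝ f x = fderiv ℝ g x := by
  obtain ⟨e, he⟩ := exists_ne (0 : F)
  set D := {x | DifferentiableAt ℝ f x} ∩ {x | DifferentiableAt ℝ g x} with hD
  have hDm : MeasurableSet D :=
    (measurableSet_of_differentiableAt ℝ f).inter (measurableSet_of_differentiableAt ℝ g)
  -- `norm_fderiv_sub_le` concerns maps from `F` to itself, so the scalar difference is multiplied
  -- by a fixed `e ≠ 0`.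
  have happ : ApproximatesLinearOn (fun x => (f x - g x) • e) (0 : F →L[ℝ] F) (A ∩ D) 0 := by
    intro x hx y hy
    simp [hfg x hx.1, hfg y hy.1]
  have h := happ.norm_fderiv_sub_le μ (hA.inter hDm)
    (fun x => (fderiv ℝ f x - fderiv ℝ g x).smulRight e) fun x hx =>
      ((hx.2.1.hasFDerivAt.sub hx.2.2.hasFDerivAt).smul_const e).hasFDerivWithinAt
  rw [ae_restrict_iff' (hA.inter hDm)] at h
  rw [ae_restrict_iff' hA]
  filter_upwards [h] with x hx hxA hf hg
  have h1 := hx ⟨hxA, hf, hg⟩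
  rw [sub_zero, nonpos_iff_eq_zero, nnnorm_eq_zero] at h1
  ext v
  have h2 := DFunLike.congr_fun h1 v
  rw [ContinuousLinearMap.smulRight_apply, zero_apply, smul_eq_zero,
    or_iff_left he] at h2
  exact sub_eq_zero.1 h2

/-- A defining function vanishes on the boundary, so its derivative would vanish at almost every
boundary point nearby, but it vanishes nowhere. -/
theorem volume_frontier_eq_zero {n : ℕ} (hn : 1 ≤ n) {O : Set (E n)} (hO : IsOfClassC2 O) :
    volume (frontier O) = 0 := by
  have : Nonempty (Fin n) := ⟨⟨0, hn⟩⟩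
  refine measure_null_of_locally_null _ fun x hx => ?_
  obtain ⟨U, φ, hxU, hU, hC, hφ⟩ := exists_isDefiningFunctionOn hO hx
  refine ⟨frontier O ∩ U, Filter.inter_mem self_mem_nhdsWithin
    (mem_nhdsWithin_of_mem_nhds (hU.mem_nhds hxU)), ?_⟩
  have hm : MeasurableSet (frontier O ∩ U) := isClosed_frontier.measurableSet.inter hU.measurableSet
  have h := ae_fderiv_eq_of_eqOn volume (f := φ) (g := fun _ => 0) hm
    fun y hy => (hφ y hy.2).2.2.1 hy.1
  rw [ae_restrict_iff' hm] at h
  refine measure_mono_null ?_ (ae_iff.1 h)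
  intro y hy hcon
  have h1 := hcon hy ((hC.contDiffAt (hU.mem_nhds hy.2)).differentiableAt (by norm_num))
    (differentiableAt_const 0)
  rw [fderiv_fun_const] at h1
  exact (hφ y hy.2).1 h1

theorem le_fderiv_of_line {F : Type*} [NormedAddCommGroup F] [NormedSpace ℝ F] {f : F → ℝ}
    {x v : F} {c : ℝ} (hf : DifferentiableAt ℝ f x)
    (h : ∀ t : ℝ, 0 < t → t ≤ 1 → f x + t * c ≤ f (x + t • v)) : c ≤ fderiv ℝ f x v := by
  have h1 := (hf.hasFDerivAt.hasLineDerivAt v).tendsto_slope_zero_right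
  refine ge_of_tendsto h1 ?_
  have h2 : ∀ᶠ t : ℝ in nhdsWithin 0 (Set.Ioi 0), t ∈ Set.Ioc (0 : ℝ) 1 :=
    Ioc_mem_nhdsGT one_pos
  filter_upwards [h2] with t ht
  have h3 := h t ht.1 ht.2
  have ht0 := ht.1
  rw [smul_eq_mul, inv_mul_eq_div, le_div_iff₀ ht0]
  linarith

/-- A function squeezed between two differentiable functions is differentiable where all three
agree. -/
theorem differentiableAt_of_squeeze {F : Type*} [NormedAddCommGroup F] [NormedSpace ℝ F]
    {f g h : F → ℝ} {x : F} (hg : DifferentiableAt ℝ g x) (hh : DifferentiableAt ℝ h x)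
    (hgf : ∀ y, g y ≤ f y) (hfh : ∀ y, f y ≤ h y) (hgx : g x = f x) (hhx : h x = f x) :
    DifferentiableAt ℝ f x := by
  have heq : fderiv ℝ h x = fderiv ℝ g x := by
    have hmin : IsLocalMin (h - g) x := Filter.Eventually.of_forall fun y => by
      simp only [Pi.sub_apply]
      linarith [hgf y, hfh y]
    have h1 := hmin.fderiv_eq_zero
    rw [fderiv_sub hh hg] at h1
    exact sub_eq_zero.1 h1
  have hh' := hh.hasFDerivAt
  rw [heq] at hh'
  have hg' := hg.hasFDerivAt
  refine ⟨fderiv ℝ g x, HasFDerivAt.of_isLittleO (Asymptotics.isLittleO_iff.2 fun c hc => ?_)⟩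
  filter_upwards [Asymptotics.isLittleO_iff.1 hh'.isLittleO hc,
    Asymptotics.isLittleO_iff.1 hg'.isLittleO hc] with y h1 h2
  rw [Real.norm_eq_abs, abs_le] at h1 h2 ⊢
  constructor <;> linarith [hgf y, hfh y, h1.1, h1.2, h2.1, h2.2]

/-! ### Gradients of `u_S` and the singular set of `d` -/

section Distance
variable {n : ℕ} {K Ω S : Set (E n)}

/-- The condition on segments gives a Lipschitz bound only on balls inside `Ω`, so Rademacher's
theorem is applied locally. -/
theorem ae_differentiableAt_of_isLip1 (hK : IsC2PlusBody K) (hΩ : IsOpen Ω) {u : E n → ℝ}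
    (hu : IsLip1 K Ω u) : ∀ᵐ x ∂volume.restrict Ω, DifferentiableAt ℝ u x := by
  obtain ⟨R, hR⟩ := lipschitzWith_of_le_rho0 hK
  rw [ae_restrict_iff' hΩ.measurableSet, ae_iff]
  refine measure_null_of_locally_null _ fun x hx => ?_
  obtain ⟨hxΩ, -⟩ := Classical.not_imp.1 hx
  obtain ⟨r, hr, hball⟩ := Metric.isOpen_iff.1 hΩ x hxΩ
  have hlip : LipschitzOnWith R u (Metric.ball x r) := hR _ _ fun a ha b hb =>
    hu.2 a b (((convex_ball x r).segment_subset ha hb).trans (hball.trans subset_closure))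
  have h := ae_iff.1 (hlip.ae_differentiableWithinAt_of_mem (μ := volume))
  refine ⟨_ ∩ Metric.ball x r, Filter.inter_mem self_mem_nhdsWithin
    (mem_nhdsWithin_of_mem_nhds (Metric.ball_mem_nhds x hr)), measure_mono_null ?_ h⟩
  intro y hy hcon
  refine hy.1 fun _ => ?_
  exact (hcon hy.2).differentiableAt (Metric.isOpen_ball.mem_nhds hy.2)

theorem ae_gradient_eq (hn : 1 ≤ n) (hK : IsC2PlusBody K) (hΩ : IsC2Domain Ω) {u v : E n → ℝ}
    (hu : IsLip1 K Ω u) (hv : IsLip1 K Ω v) {A : Set (E n)} (hA : IsClosed A)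
    (hAΩ : A ⊆ closure Ω) (huv : ∀ x ∈ A, u x = v x) :
    ∀ᵐ x ∂volume.restrict A, DifferentiableAt ℝ u x ∧ DifferentiableAt ℝ v x ∧
      gradient u x = gradient v x := by
  have : Nonempty (Fin n) := ⟨⟨0, hn⟩⟩
  have h1 := ae_fderiv_eq_of_eqOn volume hA.measurableSet huv
  have h2 := ae_differentiableAt_of_isLip1 hK hΩ.isOpen hu
  have h3 := ae_differentiableAt_of_isLip1 hK hΩ.isOpen hv
  have h4 : ∀ᵐ x ∂(volume : Measure (E n)), x ∉ frontier Ω :=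
    measure_eq_zero_iff_ae_notMem.1 (volume_frontier_eq_zero hn hΩ.classC2)
  rw [ae_restrict_iff' hΩ.isOpen.measurableSet] at h2 h3
  rw [ae_restrict_iff' hA.measurableSet] at h1 ⊢
  filter_upwards [h1, h2, h3, h4] with x hx1 hx2 hx3 hx4 hxA
  have hxΩ : x ∈ Ω := by
    by_contra hcon
    exact hx4 (by rw [hΩ.isOpen.frontier_eq]; exact ⟨hAΩ hxA, hcon⟩)
  refine ⟨hx2 hxΩ, hx3 hxΩ, ?_⟩
  rw [gradient, gradient, hx1 hxA (hx2 hxΩ) (hx3 hxΩ)]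

theorem isLip1_minkDist (hK : IsC2PlusBody K) (hF : IsCompact (frontier Ω))
    (hFn : (frontier Ω).Nonempty) : IsLip1 K Ω (minkDist K Ω) :=
  ⟨(continuous_minkDist hK hF hFn).continuousOn, fun x y _ => minkDist_sub_le hK hF hFn x y⟩

theorem fderiv_le_rho0 {f : E n → ℝ} {x : E n} (hf : DifferentiableAt ℝ f x)
    (hlip : ∀ y, f y - f x ≤ rho0 K (y - x)) (v : E n) : fderiv ℝ f x v ≤ rho0 K v := by
  have h := le_fderiv_of_line (f := -f) (c := -rho0 K v) (v := v) hf.neg fun t ht _ => by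
    have h1 := hlip (x + t • v)
    rw [add_sub_cancel_left, rho0_smul ht.le] at h1
    simp only [Pi.neg_apply]
    linarith
  rw [fderiv_neg, neg_apply] at h
  linarith

/-- A function below `d` that touches it at `x` has the maximal slope along the rays from the
projections of `x`. -/
theorem rho0_le_fderiv_of_le_minkDist (hK : IsC2PlusBody K) (hF : IsCompact (frontier Ω))
    (hFn : (frontier Ω).Nonempty) {f : E n → ℝ} {x y : E n} (hf : DifferentiableAt ℝ f x)
    (hle : ∀ w, f w ≤ minkDist K Ω w) (hx : f x = minkDist K Ω x) (hy : y ∈ proj K Ω x) :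
    rho0 K (x - y) ≤ fderiv ℝ f x (x - y) := by
  have h := le_fderiv_of_line (f := -f) (c := rho0 K (x - y)) (v := y - x) hf.neg fun t ht ht1 => by
    have hw : x + t • (y - x) ∈ segment ℝ y x :=
      ⟨t, 1 - t, ht.le, by linarith, by ring, by module⟩
    have h1 := (minkDist_segment hK hF hFn hy hw).1
    have h2 : x - (x + t • (y - x)) = t • (x - y) := by module
    rw [h2, rho0_smul ht.le] at h1
    have h3 := hle (x + t • (y - x))
    simp only [Pi.neg_apply]
    linarith
  rwa [fderiv_neg, neg_apply, ← map_neg, neg_sub] at h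

/-- If a maximizer `z` differs from `x`, `u_S` grows at full rate towards `z`; if `z = x`, `u_S`
touches `d` from below and inherits its slope along the ray from a projection. -/
theorem rho_gradient_uS_eq_one (hK : IsC2PlusBody K) (hF : IsCompact (frontier Ω))
    (hFn : (frontier Ω).Nonempty) (hS : IsCompact S) {x : E n} (hx : x ∉ frontier Ω)
    (hd : DifferentiableAt ℝ (uS K Ω S) x) : rho K (gradient (uS K Ω S) x) = 1 := by
  have hg : ∀ w, inner ℝ (gradient (uS K Ω S) x) w = fderiv ℝ (uS K Ω S) x w := fun w => by
    rw [gradient, InnerProductSpace.toDual_symm_apply]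
  have hle : ∀ w, inner ℝ (gradient (uS K Ω S) x) w ≤ rho0 K w := fun w => by
    rw [hg]
    exact fderiv_le_rho0 hd (fun y => uS_sub_le hK hF hFn hS y x) w
  obtain ⟨z, hz, h⟩ := (exists_uS_eq hK hF hFn hS x).1
  rcases eq_or_ne z x with rfl | hzx
  · obtain ⟨y, hy⟩ := proj_nonempty hK hF hFn z
    refine rho_eq_one hK hle (v := z - y) (sub_ne_zero.2 ?_) ?_
    · rintro rfl
      exact hx hy.1
    · rw [hg]
      exact rho0_le_fderiv_of_le_minkDist hK hF hFn hd (uS_le_minkDist hK hF hFn hS)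
        (uS_eq_minkDist_of_mem hK hF hFn hS hz) hy
  · refine rho_eq_one hK hle (v := z - x) (sub_ne_zero.2 hzx) ?_
    rw [hg]
    refine le_fderiv_of_line hd fun t ht ht1 => ?_
    have h1 := (exists_uS_eq hK hF hFn hS (x + t • (z - x))).2 z hz
    have h2 : z - (x + t • (z - x)) = (1 - t) • (z - x) := by module
    rw [h2, rho0_smul (by linarith)] at h1
    linarith

/-- The function `d` lies between `d(z) - ρ⁰(z - ·)` and `ρ⁰(· - y)`, both differentiable at `x` and
equal to `d` there. -/
theorem differentiableAt_minkDist (hK : IsC2PlusBody K) (hF : IsCompact (frontier Ω))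
    (hFn : (frontier Ω).Nonempty) {x z : E n} (hx : x ∉ frontier Ω) (hzx : z ≠ x)
    (h : minkDist K Ω z = minkDist K Ω x + rho0 K (z - x)) :
    DifferentiableAt ℝ (minkDist K Ω) x := by
  obtain ⟨y, hy⟩ := proj_nonempty hK hF hFn x
  have hxy : x - y ≠ 0 := sub_ne_zero.2 (by rintro rfl; exact hx hy.1)
  obtain ⟨p, -, hp⟩ := differentiableAt_rho0 hK hxy
  obtain ⟨q, -, hq⟩ := differentiableAt_rho0 hK (sub_ne_zero.2 hzx)
  refine differentiableAt_of_squeeze (g := fun w => minkDist K Ω z - rho0 K (z - w))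
    (h := fun w => rho0 K (w - y)) ?_ ?_ (fun w => ?_) (fun w => minkDist_le hy.1 w) ?_ hy.2.symm
  · exact (hq.differentiableAt.comp x (differentiableAt_id.const_sub z)).const_sub _
  · exact hp.differentiableAt.comp x (differentiableAt_id.sub_const y)
  · linarith [minkDist_sub_le hK hF hFn z w]
  · linarith

/-- If `d` is differentiable near `z`, then it grows at the maximal rate from `z` to some point of
every small sphere around `z`. -/
theorem exists_minkDist_ge_add (hK : IsC2PlusBody K) (hF : IsCompact (frontier Ω))
    (hFn : (frontier Ω).Nonempty) {z : E n} {δ : ℝ} (hδ : 0 < δ)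
    (hdiff : ∀ w ∈ Metric.ball z δ, w ∉ frontier Ω ∧ DifferentiableAt ℝ (minkDist K Ω) w) :
    ∃ w ∈ Metric.sphere z δ, minkDist K Ω z + rho0 K (w - z) ≤ minkDist K Ω w := by
  have hd := continuous_minkDist hK hF hFn
  have hr := continuous_rho0 hK
  -- With a loss `ε` in the rate, maximize `d` over the ball points reached at rate `1 - ε`. An
  -- interior maximizer could be moved along `w - y`, where the slope exceeds that rate and is
  -- positive, so the maximizer is on the sphere.
  have key : ∀ ε : ℝ, 0 < ε → ε ≤ 1 → ∃ w ∈ Metric.sphere z δ,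
      minkDist K Ω z + (1 - ε) * rho0 K (w - z) ≤ minkDist K Ω w := by
    intro ε hε hε1
    have hA : IsCompact (Metric.closedBall z δ ∩
        {w | minkDist K Ω z + (1 - ε) * rho0 K (w - z) ≤ minkDist K Ω w}) :=
      (isCompact_closedBall z δ).inter_right (isClosed_le (by fun_prop) hd)
    obtain ⟨w, ⟨hwb, hw⟩, hmax⟩ := hA.exists_isMaxOn
      ⟨z, Metric.mem_closedBall_self hδ.le, by simp [rho0_zero]⟩ hd.continuousOn
    rw [Set.mem_ofPred_eq] at hw
    refine ⟨w, ?_, hw⟩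
    by_contra hws
    have hwball : w ∈ Metric.ball z δ :=
      lt_of_le_of_ne (Metric.mem_closedBall.1 hwb) hws
    obtain ⟨hwf, hwd⟩ := hdiff w hwball
    obtain ⟨y, hy⟩ := proj_nonempty hK hF hFn w
    have hv : 0 < rho0 K (w - y) :=
      rho0_pos hK (sub_ne_zero.2 (by rintro rfl; exact hwf hy.1))
    have h1 := rho0_le_fderiv_of_le_minkDist hK hF hFn hwd (fun _ => le_rfl) rfl hy
    have h2 : (1 - ε) * rho0 K (w - y) < fderiv ℝ (minkDist K Ω) w (w - y) := by nlinarith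
    have h3 := ((hwd.hasFDerivAt.hasLineDerivAt (w - y)).tendsto_slope_zero_right).eventually
      (lt_mem_nhds (max_lt h2 (hv.trans_le h1)))
    have h4 : ∀ᶠ t : ℝ in nhdsWithin 0 (Set.Ioi 0), w + t • (w - y) ∈ Metric.ball z δ := by
      have hc : ContinuousAt (fun t : ℝ => w + t • (w - y)) 0 := by fun_prop
      refine (hc.eventually_mem ?_).filter_mono nhdsWithin_le_nhds
      rw [zero_smul, add_zero]
      exact Metric.isOpen_ball.mem_nhds hwball
    obtain ⟨t, ⟨h5, h6⟩, ht : 0 < t⟩ := ((h3.and h4).and self_mem_nhdsWithin).exists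
    rw [smul_eq_mul, inv_mul_eq_div, max_lt_iff, lt_div_iff₀ ht, lt_div_iff₀ ht,
      zero_mul] at h5
    have h7 := rho0_sub_triangle hK (w + t • (w - y)) w z
    rw [add_sub_cancel_left, rho0_smul ht.le] at h7
    have h8 : (1 - ε) * rho0 K (w + t • (w - y) - z) ≤
        (1 - ε) * (t * rho0 K (w - y) + rho0 K (w - z)) :=
      mul_le_mul_of_nonneg_left h7 (by linarith)
    have h9 : minkDist K Ω (w + t • (w - y)) ≤ minkDist K Ω w :=
      hmax ⟨Metric.ball_subset_closedBall h6, by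
        rw [Set.mem_ofPred_eq]
        linarith [h5.1]⟩
    linarith [h5.2]
  -- The case `ε = 1` only shows that the sphere is nonempty; compactness of the sphere then removes
  -- the loss.
  obtain ⟨w₁, hw₁, -⟩ := key 1 one_pos le_rfl
  obtain ⟨w, hw, hmax⟩ := (isCompact_sphere z δ).exists_isMaxOn ⟨w₁, hw₁⟩
    (f := fun w => minkDist K Ω w - rho0 K (w - z)) (by fun_prop)
  obtain ⟨R, hR⟩ := exists_rho0_le hK
  refine ⟨w, hw, le_of_forall_pos_le_add fun η hη => ?_⟩
  set ε := min 1 (η / (R * δ + 1)) with hε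
  have hpos : 0 < R * δ + 1 := by positivity
  obtain ⟨w', hw', h⟩ := key ε (by positivity) (min_le_left _ _)
  have h1 : minkDist K Ω w' - rho0 K (w' - z) ≤ minkDist K Ω w - rho0 K (w - z) := hmax hw'
  have h2 := hR (w' - z)
  rw [mem_sphere_iff_norm.1 hw'] at h2
  have h3 : ε * (R * δ + 1) ≤ η := by
    rw [← le_div_iff₀ hpos]; exact min_le_right _ _
  have h4 : ε * rho0 K (w' - z) ≤ ε * (R * δ + 1) := by
    have : 0 < ε := by positivity
    gcongr
    linarith
  linarith

theorem uS_eq_minkDist_iff (hK : IsC2PlusBody K) (hΩ : IsC2Domain Ω)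
    (hFn : (frontier Ω).Nonempty) (hS : IsCompact S) :
    (∀ x ∈ closure Ω, uS K Ω S x = minkDist K Ω x) ↔ singularSet K Ω ⊆ S := by
  have hF := isCompact_frontier hΩ
  have hd := continuous_minkDist hK hF hFn
  have hr := continuous_rho0 hK
  have hΩf : ∀ x ∈ Ω, x ∉ frontier Ω := fun x hx hxf => by
    rw [hΩ.isOpen.frontier_eq] at hxf
    exact hxf.2 hx
  constructor
  · rintro h x ⟨hx, hxd⟩
    obtain ⟨z, hz, hzx⟩ := (exists_uS_eq hK hF hFn hS x).1
    rw [h x (subset_closure hx)] at hzx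
    rcases eq_or_ne z x with rfl | hne
    · exact hz.resolve_right (hΩf z hx)
    · exact absurd (differentiableAt_minkDist hK hF hFn (hΩf x hx) hne (by linarith)) hxd
  · intro hsub x hx
    by_cases hxf : x ∈ frontier Ω
    · exact uS_eq_minkDist_of_mem hK hF hFn hS (Or.inr hxf)
    -- Follow maximal growth from `x` as far as possible: `z` has the largest `d` among the points
    -- reached at full rate. Outside `S` it could be continued to `w`, still reached at full rate
    -- from `x`, with `d(w) > d(z)`.
    have hA : IsCompact (closure Ω ∩
        {z | minkDist K Ω z = minkDist K Ω x + rho0 K (z - x)}) :=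
      (isCompact_closure hΩ).inter_right (isClosed_eq hd (by fun_prop))
    obtain ⟨z, ⟨hzc, hz⟩, hmax⟩ := hA.exists_isMaxOn
      ⟨x, hx, by simp [rho0_zero]⟩ hd.continuousOn
    rw [Set.mem_ofPred_eq] at hz
    by_cases hzS : z ∈ S
    · exact uS_eq_minkDist_of_mem_transportSet hK hF hFn hS
        ((mem_transportSet_iff hK hF hFn hS).2 ⟨z, hzS, hz⟩)
    exfalso
    have hzf : z ∉ frontier Ω := by
      rw [← minkDist_eq_zero_iff hK hF hFn] at hxf ⊢
      have h1 := (minkDist_nonneg hK hF hFn x).lt_of_ne' hxf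
      have h2 := rho0_nonneg (K := K) (z - x)
      rw [hz]
      positivity
    have hzΩ : z ∈ Ω := by
      by_contra hcon
      exact hzf (by rw [hΩ.isOpen.frontier_eq]; exact ⟨hzc, hcon⟩)
    obtain ⟨r, hr0, hball⟩ := Metric.isOpen_iff.1 (hΩ.isOpen.inter hS.isClosed.isOpen_compl) z
      ⟨hzΩ, hzS⟩
    have hhalf : Metric.closedBall z (r / 2) ⊆ Metric.ball z r :=
      Metric.closedBall_subset_ball (by linarith)
    obtain ⟨w, hw, hle⟩ := exists_minkDist_ge_add hK hF hFn (half_pos hr0) fun w hw => by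
      obtain ⟨hwΩ, hwS⟩ := hball (hhalf (Metric.ball_subset_closedBall hw))
      refine ⟨hΩf w hwΩ, ?_⟩
      by_contra hcon
      exact hwS (hsub ⟨hwΩ, hcon⟩)
    have hwΩ := (hball (hhalf (Metric.sphere_subset_closedBall hw))).1
    have h1 := rho0_sub_triangle hK w z x
    have h2 := minkDist_sub_le hK hF hFn w x
    have h3 : minkDist K Ω w ≤ minkDist K Ω z :=
      hmax ⟨subset_closure hwΩ, by
        rw [Set.mem_ofPred_eq]
        linarith⟩
    have h4 : 0 < rho0 K (w - z) :=
      rho0_pos hK (sub_ne_zero.2 (Metric.ne_of_mem_sphere hw (half_pos hr0).ne'))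
    linarith

end Distance

end MinkowskiDist

/-! ### The main theorem -/

open MinkowskiDist in
theorem corollary4p11 (n : ℕ) (hn : 1 ≤ n) (K Ω S : Set (EuclideanSpace ℝ (Fin n)))
    (hK : IsC2PlusBody K) (hΩ : IsC2Domain Ω)
    (hS : S.Nonempty) (hSc : IsClosed S) (hSΩ : S ⊆ closure Ω) :
    IsLip01 K Ω (uS K Ω S) ∧
    -- (i)
    (IsClosed (transportSet K Ω S) ∧ S ⊆ transportSet K Ω S ∧
      (∀ x ∈ transportSet K Ω S, uS K Ω S x = minkDist K Ω x) ∧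
      ∀ᵐ x ∂(volume.restrict (transportSet K Ω S)),
        DifferentiableAt ℝ (uS K Ω S) x ∧ DifferentiableAt ℝ (minkDist K Ω) x ∧
          gradient (uS K Ω S) x = gradient (minkDist K Ω) x) ∧
    -- (ii)
    (∀ᵐ x ∂(volume.restrict Ω),
      DifferentiableAt ℝ (uS K Ω S) x ∧ rho K (gradient (uS K Ω S) x) = 1) ∧
    -- (iii)
    (∀ u : EuclideanSpace ℝ (Fin n) → ℝ, IsLip01 K Ω u →
      (∀ x ∈ S, u x = minkDist K Ω x) →
        (∀ x ∈ closure Ω, uS K Ω S x ≤ u x ∧ u x ≤ minkDist K Ω x) ∧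
        ∀ᵐ x ∂(volume.restrict (transportSet K Ω S)),
          DifferentiableAt ℝ u x ∧ DifferentiableAt ℝ (minkDist K Ω) x ∧
            gradient u x = gradient (minkDist K Ω) x) ∧
    -- (iv)
    ((∀ x ∈ closure Ω, uS K Ω S x = minkDist K Ω x) ↔ singularSet K Ω ⊆ S) := by
  have hFn := frontier_nonempty hn hΩ
  have hF := isCompact_frontier hΩ
  have hSk : IsCompact S := (isCompact_closure hΩ).of_isClosed_subset hSc hSΩ
  have hlip := isLip01_uS hK hF hFn hSk
  have hdlip := isLip1_minkDist hK hF hFn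
  have hTc := isClosed_transportSet hK hΩ hFn hSk hSΩ
  have hTΩ := transportSet_subset_closure hK hF hFn hSΩ
  have hTeq : ∀ x ∈ transportSet K Ω S, uS K Ω S x = minkDist K Ω x := fun x hx =>
    uS_eq_minkDist_of_mem_transportSet hK hF hFn hSk hx
  refine ⟨hlip, ⟨hTc, subset_transportSet hK hF hFn hSk, hTeq,
    ae_gradient_eq hn hK hΩ hlip.1 hdlip hTc hTΩ hTeq⟩, ?_, fun u hu huS => ?_,
    uS_eq_minkDist_iff hK hΩ hFn hSk⟩
  · filter_upwards [ae_differentiableAt_of_isLip1 hK hΩ.isOpen hlip.1,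
      ae_restrict_mem hΩ.isOpen.measurableSet] with x hxd hx
    refine ⟨hxd, rho_gradient_uS_eq_one hK hF hFn hSk (fun hxf => ?_) hxd⟩
    rw [hΩ.isOpen.frontier_eq] at hxf
    exact hxf.2 hx
  · have hbd : ∀ x ∈ closure Ω, uS K Ω S x ≤ u x ∧ u x ≤ minkDist K Ω x := fun x hx =>
      ⟨uS_le_of_isLip01 hK hF hFn hSk hu huS hx, le_minkDist_of_isLip01 hK hF hFn hu hx⟩
    refine ⟨hbd, ae_gradient_eq hn hK hΩ hu.1 hdlip hTc hTΩ fun x hx => ?_⟩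
    obtain ⟨h1, h2⟩ := hbd x (hTΩ hx)
    -- On `T_S^e` the bounds `u_S ≤ u ≤ d` collapse because `u_S = d` there.
    exact le_antisymm h2 ((hTeq x hx).ge.trans h1)
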